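/- Let $d\ge 1$, and let $X\subseteq\mathbb{R}^d$ be a convex set containing a closed $\ell_\infty$-ball of radius $r>0$. Let $p,q\in[1,\infty]$ with $1/p+1/q=1$, let $G\in(0,\infty)$ and let $\tau\ge 1$ be an integer. Let $\mathcal F$ be the set of convex functions $f:X\to\mathbb R$ with $|f(x)-f(y)|\le G\|x-y\|_q$ for all $x,y\in X$, and for $f\in\mathcal F$ and $x\in X$ let $\partial f(x)=\{g\in\mathbb R^d: f(y)\ge f(x)+\langle g,y-x\rangle\ \forall y\in X\}$. An oracle is a pair $\mathsf O=(P,\mathsf G)$ of a stochastic process $P$ generating samples $\xi_1,\xi_2,\dots$ in a standard Borel space $\Xi$ and a measurable map $\mathsf G:X\times\Xi\to\mathbb R^d$; at the $t$-th query $x(t)\in X$ it answers $\mathsf G(x(t),\xi_t)$. It is admissible for $f$, written $\mathsf O\in\mathcal O(f,\tau,G,p)$, if there is a probability distribution $\Pi$ on $\Xi$ such that $\|\mathsf G(x,\xi)\|_p\le G$ for all $x\in X$ and $\xi\in\Xi$, $\mathbb E_{\xi\sim\Pi}[\mathsf G(x,\xi)]\in\partial f(x)$ for all $x\in X$, and,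 with probability $1$, for every integer $t\ge 0$ the conditional distribution of $\xi_{t+\tau}$ given $\xi_1,\dots,\xi_t$ has total variation distance $0$ from $\Pi$ (so the mixing time is at most $\tau$). A method $\mathcal M$ chooses, by measurable functions, each query $x(t+1)\in X$ from the first $t$ answers and, after $T$ queries, an estimate $\widehat x_T\in X$ from the $T$ answers. Define the minimax error $$\epsilon_T^*(\mathcal F,X,\tau,G,p)=\inf_{\mathcal M}\ \sup_{f\in\mathcal F}\ \sup_{\mathsf O\in\mathcal O(f,\tau,G,p)}\ \mathbb E_{\mathsf O}\Big[f(\widehat x_T)-\inf_{x\in X}f(x)\Big]\in[0,\infty].$$ Then there are a universal constant $c>0$ and a universal $N\in\mathbb N$ (independent of $d,X,r,G,p,q,\tau,T$) such that: (a) if $p\in[1,2]$, then $\epsilon_T^*(\mathcal F,X,\tau,G,p)\ \ge\ c\,G\,r\,\sqrt d\,\sqrt{\tau/T}$ for all integers $T\ge N d\tau$; (b) if $p\in[2,\infty]$, then $\epsilon_T^*(\mathcal F,X,\tau,G,p)\ \ge\ c\,G\,r\,d^{1/q}\,\sqrt{\tau/T}$ for all integers $T\ge N\tau$. -/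

import Mathlib

open MeasureTheory ProbabilityTheory
open scoped ENNReal

namespace ErgodicOracle

/-- The `ℓ_p` norm on `ℝ^d`, for `p ∈ [1, ∞]`. -/
noncomputable def ellNorm {d : ℕ} (p : ℝ≥0∞) (x : Fin d → ℝ) : ℝ :=
  ‖(WithLp.toLp p x : PiLp p fun _ : Fin d => ℝ)‖

/-- The subdifferential at `x` of a function `f` on the set `X`. Functions on `X` are represented
by functions on the whole space, whose values outside `X` are never used. -/
def subdifferential {d : ℕ} (X : Set (Fin d → ℝ)) (f : (Fin d → ℝ) → ℝ) (x : Fin d → ℝ) :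
    Set (Fin d → ℝ) :=
  {g | ∀ y ∈ X, f x + g ⬝ᵥ (y - x) ≤ f y}

/-- The convex functions on `X` that are `G`-Lipschitz over `X` with respect to the `ℓ_q` norm. -/
def convexLipschitz {d : ℕ} (X : Set (Fin d → ℝ)) (G : ℝ) (q : ℝ≥0∞) :
    Set ((Fin d → ℝ) → ℝ) :=
  {f | ConvexOn ℝ X f ∧ ∀ x ∈ X, ∀ y ∈ X, |f x - f y| ≤ G * ellNorm q (x - y)}

/-- The total variation distance `2 sup_A |P(A) - Q(A)|`, over measurable sets `A`. -/
noncomputable def tvDist {Ξ : Type} [MeasurableSpace Ξ] (P Q : Measure Ξ) : ℝ≥0∞ :=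
  2 * ⨆ (A : Set Ξ) (_ : MeasurableSet A), ENNReal.ofReal |P.real A - Q.real A|

/-- A stochastic subgradient oracle on `X`: a stochastic process `ξ_1, ξ_2, …` with values in a
sample space `Ξ`, given by its law on sequences (the entry `ω i` is the sample `ξ_{i+1}`), and a
measurable map `(x, ξ) ↦ G(x; ξ) ∈ ℝ^d`. The sample space is standard Borel, so that regular
conditional distributions exist. -/
structure Oracle {d : ℕ} (X : Set (Fin d → ℝ)) : Type 1 where
  /-- the sample space -/
  Ξ : Type
  [measurableSpace : MeasurableSpace Ξ]
  [standardBorel : StandardBorelSpace Ξ]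
  [nonempty : Nonempty Ξ]
  /-- the law of the sample sequence -/
  law : Measure (ℕ → Ξ)
  [isProbabilityMeasure : IsProbabilityMeasure law]
  /-- the answer to the query `x` if the current sample is `ξ` -/
  grad : X → Ξ → (Fin d → ℝ)
  measurable_grad : Measurable (Function.uncurry grad)

attribute [instance] Oracle.measurableSpace Oracle.standardBorel Oracle.nonempty
  Oracle.isProbabilityMeasure

namespace Oracle

variable {d : ℕ} {X : Set (Fin d → ℝ)}

/-- The conditional distribution of `ξ_t` given the first `s` samples `ξ_1, …, ξ_s`, along the
sample sequence `ω` (for `t ≥ 1`; the sample `ξ_t` is `ω (t - 1)`). -/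
noncomputable def condLaw (O : Oracle X) (s t : ℕ) (ω : ℕ → O.Ξ) : Measure O.Ξ :=
  condDistrib (fun ω' : ℕ → O.Ξ => ω' (t - 1))
    (fun (ω' : ℕ → O.Ξ) (i : Fin s) => ω' i) O.law (fun i : Fin s => ω i)

end Oracle

/-- The admissible oracles for `f`: there is a probability distribution `π` on the samples such
that the answers are `ℓ_p`-bounded by `G`, their `π`-expectations are subgradients of `f`, and the
samples mix to `π` in `τ` steps. -/
def admissibleOracles {d : ℕ} (X : Set (Fin d → ℝ)) (f : (Fin d → ℝ) → ℝ) (τ : ℕ) (G : ℝ)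
    (p : ℝ≥0∞) : Set (Oracle X) :=
  {O | ∃ π : Measure O.Ξ, IsProbabilityMeasure π ∧
    (∀ (x : X) (ξ : O.Ξ), ellNorm p (O.grad x ξ) ≤ G) ∧
    (∀ x : X, ∫ ξ, O.grad x ξ ∂π ∈ subdifferential X f x) ∧
    (∀ t : ℕ, ∀ᵐ ω ∂O.law, tvDist (O.condLaw t (t + τ) ω) π = 0)}

/-- An optimization method on `X`. From the first `t` answers of the oracle it computes its next
query `x(t+1) ∈ X`, and its estimate in `X` of the minimizer after `t` queries. -/
structure Method {d : ℕ} (X : Set (Fin d → ℝ)) where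
  query : (t : ℕ) → (Fin t → (Fin d → ℝ)) → X
  estimate : (t : ℕ) → (Fin t → (Fin d → ℝ)) → X
  measurable_query : ∀ t, Measurable (query t)
  measurable_estimate : ∀ t, Measurable (estimate t)

namespace Method

variable {d : ℕ} {X : Set (Fin d → ℝ)}

/-- The first `t` answers that the method `M` receives from the oracle `O` along the sample
sequence `ω`. -/
def answers (M : Method X) (O : Oracle X) (ω : ℕ → O.Ξ) : (t : ℕ) → Fin t → (Fin d → ℝ)
  | 0 => Fin.elim0
  | t + 1 => Fin.snoc (α := fun _ => Fin d → ℝ) (M.answers O ω t)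
      (O.grad (M.query t (M.answers O ω t)) (ω t))

/-- The optimality gap `f(x̂) - inf_X f` after `T` queries. It is `⊤` if `f` is unbounded below
on `X`, and it is never negative, as the estimate lies in `X`. -/
noncomputable def optGap (M : Method X) (T : ℕ) (f : (Fin d → ℝ) → ℝ) (O : Oracle X)
    (ω : ℕ → O.Ξ) : EReal :=
  (f (M.estimate T (M.answers O ω T)) : EReal) - ⨅ x : X, (f x : EReal)

/-- The expected optimality gap after `T` queries. -/
noncomputable def expectedGap (M : Method X) (T : ℕ) (f : (Fin d → ℝ) → ℝ) (O : Oracle X) :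
    ℝ≥0∞ :=
  ∫⁻ ω, (M.optGap T f O ω).toENNReal ∂O.law

end Method

/-- The minimax error after `T` queries over the functions in `F` and their admissible oracles. -/
noncomputable def minimaxError {d : ℕ} (T : ℕ) (F : Set ((Fin d → ℝ) → ℝ))
    (X : Set (Fin d → ℝ)) (τ : ℕ) (G : ℝ) (p : ℝ≥0∞) : ℝ≥0∞ :=
  ⨅ M : Method X, ⨆ f ∈ F, ⨆ O ∈ admissibleOracles X f τ G p, M.expectedGap T f O

end ErgodicOracle

/-!
The hard problems encode unknown bits in the signs of the minimizers. The coordinates are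
partitioned into `k` blocks, each with a bit `v j`, and `hardFun` is a sum over the coordinates of
the biased absolute values
`(1 / 2 + δ s) |u + r| + (1 / 2 - δ s) |u - r|`, where `s = ±1` is the bit of the block and `u` is
the coordinate relative to the centre of the ball. Such a function is minimal at `u = - s r`, inside
the ball, so that its infimum over `X` is attained whatever `X` is, and a point whose
coordinate `u` has the wrong sign loses at least `2 δ r` there, up to the scaling (`le_hardFun_sub`).

A sample of the oracle is a uniformly distributed block `j` and a bit that agrees with `v j` with
probability `1 / 2 + δ`. The answer is a subgradient of `|u ± r|` along the coordinates of the
block `j` alone; as a function of the point and the sample it does not depend on `v`, so that a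
method learns about `v` through the law of the samples only. Each independent sample is repeated `τ`
times (`blockLaw`). Samples at distance `τ` then come from different repetitions, so the
conditional laws in the mixing condition are exactly the stationary law
(`condDistrib_blockLaw_ae_eq`), while `T` queries reveal only `n ≤ 2 T / τ` independent samples
(`lintegral_blockLaw`).

Flipping one bit changes the distribution of a sample by a `χ²`-divergence of order `δ² / k`. The
divergence tensorizes, so with `δ` of order `√(k τ / T)` the laws of the `n` samples
remain close (`abs_sum_prod_sampleWeight_sub_le`), and by Assouad's argument every coordinate is on
the wrong side with probability at least `1 / 4` on average over `v`
(`two_pow_div_four_le_sum_error`). This gives `le_minimaxError_of_block`. The bound for `p ≤ 2` uses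
the partition into single coordinates, with sparse answers of size `G`; the bound for
`2 ≤ p` uses a single block, with answers of full support and entries `± G / d ^ (1 / p)`.
-/

namespace ErgodicOracle

/-! ### The `ℓ_p` norms -/

lemma ellNorm_of_eq_single {d : ℕ} {p : ℝ≥0∞} (hp : 1 ≤ p) {x : Fin d → ℝ} {j : Fin d}
    (hx : ∀ i, i ≠ j → x i = 0) : ellNorm p x = |x j| := by
  have : Fact (1 ≤ p) := ⟨hp⟩
  have h : x = Pi.single j (x j) := by
    ext i
    rcases eq_or_ne i j with rfl | hij
    · simp
    · simp [hij, hx i hij]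
  rw [ellNorm, h, PiLp.toLp_single, PiLp.norm_single]
  simp

lemma ellNorm_le_of_forall_abs_le {d : ℕ} {p : ℝ≥0∞} (hp : 1 ≤ p) {x : Fin d → ℝ} {A : ℝ}
    (hA : 0 ≤ A) (hx : ∀ i, |x i| ≤ A) : ellNorm p x ≤ (d : ℝ) ^ (1 / p).toReal * A := by
  rcases eq_or_ne p ∞ with rfl | hp'
  · rw [ellNorm, PiLp.norm_eq_ciSup]
    simpa using Real.iSup_le (fun i => by simpa using hx i) hA
  · have hp0 : 0 < p.toReal := ENNReal.toReal_pos (by positivity) hp'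
    rw [ellNorm, PiLp.norm_eq_sum hp0]
    calc (∑ i, ‖x i‖ ^ p.toReal) ^ (1 / p.toReal)
        ≤ ((d : ℝ) * A ^ p.toReal) ^ (1 / p.toReal) := by
          refine Real.rpow_le_rpow (by positivity) ?_ (by positivity)
          refine (Finset.sum_le_card_nsmul _ _ (A ^ p.toReal) fun i _ => ?_).trans_eq (by simp)
          exact Real.rpow_le_rpow (norm_nonneg _) (hx i) hp0.le
      _ = (d : ℝ) ^ (1 / p).toReal * A := by
          rw [Real.mul_rpow (by positivity) (by positivity), one_div, one_div,
            Real.rpow_rpow_inv hA hp0.ne', ENNReal.toReal_inv]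

lemma sum_abs_le_ellNorm {d : ℕ} {p q : ℝ≥0∞} (hq : 1 ≤ q) (hpq : 1 / p + 1 / q = 1)
    (x : Fin d → ℝ) : ∑ i, |x i| ≤ (d : ℝ) ^ (1 / p).toReal * ellNorm q x := by
  have : Fact (1 ≤ q) := ⟨hq⟩
  have h1 : (1 / p).toReal + (1 / q).toReal = 1 := by
    rw [← ENNReal.toReal_add, hpq, ENNReal.toReal_one]
    · intro h; simp [h] at hpq
    · intro h; simp [h] at hpq
  rcases eq_or_ne q ∞ with rfl | hq'
  · have h2 : (1 / p).toReal = 1 := by simpa using h1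
    rw [h2, Real.rpow_one]
    refine (Finset.sum_le_card_nsmul _ _ (ellNorm ∞ x) fun i _ => ?_).trans_eq (by simp)
    exact PiLp.norm_apply_le (WithLp.toLp ∞ x) i
  · have hq1 : 1 ≤ q.toReal := by simpa using ENNReal.toReal_mono hq' hq
    have hq0 : 0 < q.toReal := by linarith
    rw [ellNorm, PiLp.norm_eq_sum hq0]
    have h := Real.rpow_sum_le_const_mul_sum_rpow Finset.univ x hq1
    have h2 := Real.rpow_le_rpow (by positivity) h (show 0 ≤ 1 / q.toReal by positivity)
    rw [Real.mul_rpow (by positivity) (by positivity), one_div,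
      Real.rpow_rpow_inv (by positivity) hq0.ne', ← Real.rpow_mul (by positivity)] at h2
    have h3 : (q.toReal - 1) * q.toReal⁻¹ = (1 / p).toReal := by
      rw [one_div q, ENNReal.toReal_inv] at h1
      rw [sub_mul, mul_inv_cancel₀ hq0.ne']
      linarith
    rw [h3] at h2
    simpa using h2

/-! ### The hard functions -/

/-- The sign `±1` encoded by a bit. -/
def bitSign (b : Bool) : ℝ := if b then 1 else -1

/-- A subgradient of the absolute value. -/
noncomputable def absSlope (t : ℝ) : ℝ := if 0 ≤ t then 1 else -1

lemma abs_absSlope (t : ℝ) : |absSlope t| = 1 := by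
  unfold absSlope; split_ifs <;> simp

lemma abs_add_absSlope_mul_le (s t : ℝ) : |s| + absSlope s * (t - s) ≤ |t| := by
  unfold absSlope
  split_ifs with h
  · rw [abs_of_nonneg h]; linarith [le_abs_self t]
  · rw [abs_of_neg (not_le.1 h)]; linarith [neg_abs_le t]

lemma measurable_absSlope : Measurable absSlope :=
  Measurable.ite measurableSet_Ici measurable_const measurable_const

/-- The sampling distribution with bias `δ` and parameter `v`: a sample is a pair of a uniformly
distributed index `j` and a bit, whose sign agrees with that of `v j` with probability
`1 / 2 + δ`. -/
noncomputable def sampleWeight {k : ℕ} (δ : ℝ) (v : Fin k → Bool) (s : Fin k × Bool) : ℝ :=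
  (1 / 2 + δ * bitSign (v s.1) * bitSign s.2) / k

lemma sampleWeight_pos {k : ℕ} {δ : ℝ} (hδ0 : 0 ≤ δ) (hδ : δ ≤ 1 / 4) (v : Fin k → Bool)
    (s : Fin k × Bool) : 0 < sampleWeight δ v s := by
  have hk : 0 < (k : ℝ) := by exact_mod_cast s.1.pos
  refine div_pos ?_ hk
  unfold bitSign
  split_ifs <;> linarith

lemma sampleWeight_true_add_false {k : ℕ} (δ : ℝ) (v : Fin k → Bool) (j : Fin k) :
    sampleWeight δ v (j, true) + sampleWeight δ v (j, false) = 1 / k := by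
  simp only [sampleWeight, bitSign]
  simp only [if_true, Bool.false_eq_true, if_false]
  ring

lemma sum_sampleWeight {k : ℕ} (hk : 1 ≤ k) (δ : ℝ) (v : Fin k → Bool) :
    ∑ s, sampleWeight δ v s = 1 := by
  have hk' : (k : ℝ) ≠ 0 := by positivity
  simp [Fintype.sum_prod_type, sampleWeight_true_add_false, hk']

/-- A sum of biased absolute values of the coordinates, centred at `a`. Along the coordinate `i`
the function is minimal at `a i ∓ r`, where the sign is given by the bit `v (block i)`. All
coordinates with the same `block i` share one unknown bit. -/
noncomputable def hardFun {d k : ℕ} (a : Fin d → ℝ) (r A δ : ℝ) (block : Fin d → Fin k)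
    (v : Fin k → Bool) (x : Fin d → ℝ) : ℝ :=
  A * ∑ i, ∑ b, sampleWeight δ v (block i, b) * |x i - a i + bitSign b * r|

/-- The oracle answer for the hard functions: it depends on the point and the sample only, and
not on the parameter of the function. -/
noncomputable def hardGrad {d k : ℕ} (a : Fin d → ℝ) (r A : ℝ) (block : Fin d → Fin k)
    (x : Fin d → ℝ) (s : Fin k × Bool) : Fin d → ℝ :=
  fun i => if block i = s.1 then A * absSlope (x i - a i + bitSign s.2 * r) else 0

section HardFun

variable {d k : ℕ} {a : Fin d → ℝ} {r A δ : ℝ} {block : Fin d → Fin k} {v : Fin k → Bool}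

lemma measurable_hardGrad (X : Set (Fin d → ℝ)) :
    Measurable (Function.uncurry fun (x : X) (s : Fin k × Bool) => hardGrad a r A block x s) := by
  refine measurable_from_prod_countable_left fun s => measurable_pi_lambda _ fun i => ?_
  change Measurable fun x : X =>
    if block i = s.1 then A * absSlope ((x : Fin d → ℝ) i - a i + bitSign s.2 * r) else 0
  split_ifs
  · refine measurable_const.mul (measurable_absSlope.comp ?_)
    exact (((measurable_pi_apply i).comp measurable_subtype_coe).sub_const _).add_const _
  · exact measurable_const

lemma sum_sampleWeight_smul_hardGrad (x : Fin d → ℝ) (i : Fin d) :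
    (∑ s, sampleWeight δ v s • hardGrad a r A block x s) i =
      A * ∑ b, sampleWeight δ v (block i, b) * absSlope (x i - a i + bitSign b * r) := by
  simp only [Finset.sum_apply, Pi.smul_apply, smul_eq_mul, hardGrad, Fintype.sum_prod_type,
    mul_ite, mul_zero]
  rw [Finset.sum_comm]
  simp only [Finset.sum_ite_eq, Finset.mem_univ, if_true, Finset.mul_sum]
  exact Finset.sum_congr rfl fun b _ => by ring

lemma sum_sampleWeight_smul_hardGrad_mem (hA : 0 ≤ A) (hδ0 : 0 ≤ δ) (hδ : δ ≤ 1 / 4)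
    (X : Set (Fin d → ℝ)) (x : Fin d → ℝ) :
    ∑ s, sampleWeight δ v s • hardGrad a r A block x s ∈
      subdifferential X (hardFun a r A δ block v) x := by
  intro y _
  simp only [dotProduct, sum_sampleWeight_smul_hardGrad, hardFun, Pi.sub_apply, mul_assoc,
    ← Finset.mul_sum, ← mul_add, ← Finset.sum_add_distrib]
  refine mul_le_mul_of_nonneg_left (Finset.sum_le_sum fun i _ => ?_) hA
  rw [Finset.sum_mul, ← Finset.sum_add_distrib]
  refine Finset.sum_le_sum fun b _ => ?_
  rw [mul_assoc, ← mul_add]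
  refine mul_le_mul_of_nonneg_left ?_ (sampleWeight_pos hδ0 hδ v _).le
  have h := abs_add_absSlope_mul_le (x i - a i + bitSign b * r) (y i - a i + bitSign b * r)
  rwa [show y i - a i + bitSign b * r - (x i - a i + bitSign b * r) = y i - x i by ring] at h

lemma convexOn_of_forall_subdifferential_nonempty {X : Set (Fin d → ℝ)} (hX : Convex ℝ X)
    {f : (Fin d → ℝ) → ℝ} (hf : ∀ x ∈ X, (subdifferential X f x).Nonempty) : ConvexOn ℝ X f := by
  refine ⟨hX, fun x hx y hy α β hα hβ hαβ => ?_⟩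
  obtain ⟨g, hg⟩ := hf _ (hX hx hy hα hβ hαβ)
  have h1 := mul_le_mul_of_nonneg_left (hg x hx) hα
  have h2 := mul_le_mul_of_nonneg_left (hg y hy) hβ
  have h3 : α * (g ⬝ᵥ (x - (α • x + β • y))) + β * (g ⬝ᵥ (y - (α • x + β • y))) = 0 := by
    simp only [dotProduct_sub, dotProduct_add, dotProduct_smul, smul_eq_mul]
    obtain rfl : β = 1 - α := by linarith
    ring
  have h4 : α * f (α • x + β • y) + β * f (α • x + β • y) = f (α • x + β • y) := by
    rw [← add_mul, hαβ, one_mul]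
  simp only [smul_eq_mul]
  linarith

lemma abs_hardFun_sub_le (hA : 0 ≤ A) (hδ0 : 0 ≤ δ) (hδ : δ ≤ 1 / 4) (x y : Fin d → ℝ) :
    |hardFun a r A δ block v x - hardFun a r A δ block v y| ≤ A / k * ∑ i, |x i - y i| := by
  unfold hardFun
  rw [← mul_sub, abs_mul, abs_of_nonneg hA, div_mul_eq_mul_div, mul_div_assoc]
  refine mul_le_mul_of_nonneg_left ?_ hA
  rw [← Finset.sum_sub_distrib, Finset.sum_div]
  refine (Finset.abs_sum_le_sum_abs _ _).trans (Finset.sum_le_sum fun i _ => ?_)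
  rw [← Finset.sum_sub_distrib]
  refine (Finset.abs_sum_le_sum_abs _ _).trans ?_
  calc ∑ b, |(sampleWeight δ v (block i, b) * |x i - a i + bitSign b * r| -
          sampleWeight δ v (block i, b) * |y i - a i + bitSign b * r|)|
      ≤ ∑ b, sampleWeight δ v (block i, b) * |x i - y i| := by
        refine Finset.sum_le_sum fun b _ => ?_
        have hw := (sampleWeight_pos hδ0 hδ v (block i, b)).le
        rw [← mul_sub, abs_mul, abs_of_nonneg hw]
        refine mul_le_mul_of_nonneg_left ((abs_abs_sub_abs_le_abs_sub _ _).trans_eq ?_) hw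
        congr 1; ring
    _ = |x i - y i| / k := by
        rw [Fintype.sum_bool, ← add_mul, sampleWeight_true_add_false]; ring

/-- The indicator that a number `t` lies on the wrong side of `0`, for a function of one variable
that is minimal on the side opposite to the sign of `b`. The number `0` is wrong for the bit `true`
only, so that every number is on the wrong side for exactly one of the two bits. -/
noncomputable def wrongSide (b : Bool) (t : ℝ) : ℝ := if b = decide (0 ≤ t) then 1 else 0

lemma wrongSide_nonneg (b : Bool) (t : ℝ) : 0 ≤ wrongSide b t := by
  unfold wrongSide; split_ifs <;> simp

lemma wrongSide_add_not (b : Bool) (t : ℝ) : wrongSide b t + wrongSide (!b) t = 1 := by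
  unfold wrongSide
  cases b <;> by_cases h : 0 ≤ t <;> simp [h]

/-- Being on the wrong side costs a fixed amount, because the slope of a biased absolute value
between its two kinks is `2 * δ`, up to sign. -/
lemma le_biased_abs_sub (hδ0 : 0 ≤ δ) (hδ : δ ≤ 1 / 4) (b : Bool) (t : ℝ) :
    2 * δ * r * wrongSide b t ≤
      (1 / 2 + δ * bitSign b) * |t + r| + (1 / 2 - δ * bitSign b) * |t - r| -
        (1 / 2 - δ) * (2 * r) := by
  have hT : 2 * r ≤ |t + r| + |t - r| := by linarith [le_abs_self (t + r), neg_abs_le (t - r)]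
  have h := mul_le_mul_of_nonneg_left hT (show 0 ≤ 1 / 2 - δ by linarith)
  have h1 := mul_nonneg hδ0 (abs_nonneg (t + r))
  have h2 := mul_nonneg hδ0 (abs_nonneg (t - r))
  unfold wrongSide bitSign
  cases b <;> by_cases ht : 0 ≤ t <;> simp [ht]
  · linarith
  · have h3 := mul_le_mul_of_nonneg_left (neg_abs_le (t - r)) hδ0
    have h4 := mul_nonneg hδ0 (sub_nonneg.2 (not_le.1 ht).le)
    linarith
  · have h3 := mul_le_mul_of_nonneg_left (le_abs_self (t + r)) hδ0
    have h4 := mul_nonneg hδ0 ht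
    linarith
  · linarith

lemma le_hardFun_sub (hA : 0 ≤ A) (hr : 0 ≤ r) (hδ0 : 0 ≤ δ) (hδ : δ ≤ 1 / 4) (x : Fin d → ℝ) :
    A / k * (2 * δ * r) * ∑ i, wrongSide (v (block i)) (x i - a i) ≤
      hardFun a r A δ block v x -
        hardFun a r A δ block v (fun i => a i - bitSign (v (block i)) * r) := by
  unfold hardFun
  rw [← mul_sub, ← Finset.sum_sub_distrib, div_mul_eq_mul_div, div_mul_eq_mul_div, mul_assoc,
    mul_div_assoc]
  refine mul_le_mul_of_nonneg_left ?_ hA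
  rw [Finset.mul_sum, Finset.sum_div]
  refine Finset.sum_le_sum fun i _ => ?_
  have h := div_le_div_of_nonneg_right
    (le_biased_abs_sub (r := r) hδ0 hδ (v (block i)) (x i - a i)) (Nat.cast_nonneg k)
  refine h.trans_eq ?_
  have h2 : |2 * r| = 2 * r := abs_of_nonneg (by linarith)
  simp only [Fintype.sum_bool, sampleWeight, sub_sub_cancel_left]
  cases v (block i)
  · simp only [bitSign, Bool.false_eq_true, if_false, if_true]
    rw [show -(-1 * r) + 1 * r = 2 * r by ring, show -(-1 * r) + -1 * r = 0 by ring, h2, abs_zero,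
      one_mul, neg_one_mul, ← sub_eq_add_neg]
    ring
  · simp only [bitSign, Bool.false_eq_true, if_false, if_true]
    rw [show -(1 * r) + 1 * r = 0 by ring, show -(1 * r) + -1 * r = -(2 * r) by ring, abs_neg, h2,
      abs_zero, one_mul, neg_one_mul, ← sub_eq_add_neg]
    ring

end HardFun

/-! ### Distinguishing product distributions -/

/-- The squared difference between the expectations, under two distributions, of a statistic of `n`
independent samples with values in `[-1, 1]` is at most the `χ²`-divergence of the two products,
by the Cauchy–Schwarz inequality; that divergence tensorizes. -/
lemma sq_sum_prod_sub_prod_mul_le {α : Type*} [Fintype α] {p q : α → ℝ} (hq : ∀ s, 0 < q s)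
    (hp1 : ∑ s, p s = 1) (hq1 : ∑ s, q s = 1) {n : ℕ} {h : (Fin n → α) → ℝ}
    (hh : ∀ z, |h z| ≤ 1) :
    (∑ z, (∏ i, p (z i) - ∏ i, q (z i)) * h z) ^ 2 ≤ (∑ s, p s ^ 2 / q s) ^ n - 1 := by
  have hQ : ∀ z : Fin n → α, 0 < ∏ i, q (z i) := fun z => Finset.prod_pos fun i _ => hq _
  have hP1 : ∑ z : Fin n → α, ∏ i, p (z i) = 1 := by rw [← Fintype.sum_pow, hp1, one_pow]
  have hQ1 : ∑ z : Fin n → α, ∏ i, q (z i) = 1 := by rw [← Fintype.sum_pow, hq1, one_pow]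
  have hchi : ∑ z : Fin n → α, (∏ i, p (z i) - ∏ i, q (z i)) ^ 2 / ∏ i, q (z i) =
      (∑ s, p s ^ 2 / q s) ^ n - 1 := by
    have : ∀ z : Fin n → α, (∏ i, p (z i) - ∏ i, q (z i)) ^ 2 / ∏ i, q (z i) =
        ∏ i, (p (z i) ^ 2 / q (z i)) - 2 * ∏ i, p (z i) + ∏ i, q (z i) := fun z => by
      rw [Finset.prod_div_distrib, Finset.prod_pow]
      have := (hQ z).ne'
      field_simp
      ring
    simp_rw [this]
    rw [Finset.sum_add_distrib, Finset.sum_sub_distrib, ← Finset.mul_sum, hP1, hQ1,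
      ← Fintype.sum_pow fun s => p s ^ 2 / q s]
    ring
  refine (Finset.sum_sq_le_sum_mul_sum_of_sq_le_mul Finset.univ
    (f := fun z => (∏ i, p (z i) - ∏ i, q (z i)) ^ 2 / ∏ i, q (z i))
    (g := fun z => ∏ i, q (z i)) (fun z _ => div_nonneg (sq_nonneg _) (hQ z).le)
    (fun z _ => (hQ z).le) fun z _ => ?_).trans_eq (by rw [hQ1, hchi, mul_one])
  rw [div_mul_cancel₀ _ (hQ z).ne', mul_pow]
  exact mul_le_of_le_one_right (sq_nonneg _) ((sq_le_one_iff_abs_le_one _).2 (hh z))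

/-- Flipping the bit `v j` gives a `χ²`-divergence of order `δ ^ 2 / k`: only the samples with index
`j`, which have probability `1 / k`, carry information on `v j`. -/
lemma sum_sq_sampleWeight_div_le {k : ℕ} (hk : 1 ≤ k) {δ : ℝ} (hδ0 : 0 ≤ δ) (hδ : δ ≤ 1 / 4)
    (v : Fin k → Bool) (j : Fin k) :
    ∑ s, sampleWeight δ v s ^ 2 / sampleWeight δ (Function.update v j (!v j)) s ≤
      1 + 22 * δ ^ 2 / k := by
  have hk0 : 0 < (k : ℝ) := by positivity
  have hd3 : 1 - 2 * δ ≠ 0 := by linarith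
  have key : ∀ i, ∑ b, sampleWeight δ v (i, b) ^ 2 /
      sampleWeight δ (Function.update v j (!v j)) (i, b) =
      1 / k + if i = j then 4 * δ ^ 2 / (1 / 4 - δ ^ 2) / k else 0 := fun i => by
    have hd : 1 / 4 - δ ^ 2 = (1 / 2 + δ) * (1 / 2 - δ) := by ring
    split_ifs with hij
    · subst hij
      rw [Fintype.sum_bool, hd]
      simp only [sampleWeight, Function.update_self, bitSign]
      cases v i <;> simp <;> rw [← sub_eq_add_neg] <;> rw [inv_eq_one_div] <;> field_simp <;> ring
    · have hw : ∀ b, sampleWeight δ (Function.update v j (!v j)) (i, b) =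
          sampleWeight δ v (i, b) := fun b => by
        simp [sampleWeight, Function.update_of_ne hij]
      simp only [hw]
      rw [add_zero, ← sampleWeight_true_add_false δ v i, Fintype.sum_bool, sq, sq,
        mul_div_cancel_right₀ _ (sampleWeight_pos hδ0 hδ v _).ne',
        mul_div_cancel_right₀ _ (sampleWeight_pos hδ0 hδ v _).ne']
  rw [Fintype.sum_prod_type]
  simp only [key, Finset.sum_add_distrib, Finset.sum_ite_eq', Finset.mem_univ, if_true]
  simp only [Finset.sum_const, Finset.card_univ, Fintype.card_fin, nsmul_eq_mul]
  rw [mul_one_div_cancel hk0.ne']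
  gcongr
  -- As `δ ^ 2 ≤ 1 / 16`, the divergence is at most `(64 / 3) * δ ^ 2 / k`.
  have h2 : δ ^ 2 ≤ 1 / 16 := by nlinarith
  rw [div_le_iff₀ (by linarith)]
  nlinarith [mul_nonneg (sq_nonneg δ) (show 0 ≤ 1 / 16 - δ ^ 2 by linarith)]

lemma abs_sum_prod_sampleWeight_sub_le {k n : ℕ} (hk : 1 ≤ k) {δ : ℝ} (hδ0 : 0 ≤ δ)
    (hδ : δ ≤ 1 / 4) (hn : n * δ ^ 2 ≤ k / 128) (v : Fin k → Bool) (j : Fin k)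
    {h : (Fin n → Fin k × Bool) → ℝ} (hh : ∀ z, |h z| ≤ 1) :
    |∑ z, (∏ i, sampleWeight δ v (z i) -
      ∏ i, sampleWeight δ (Function.update v j (!v j)) (z i)) * h z| ≤ 1 / 2 := by
  have hk0 : 0 < (k : ℝ) := by positivity
  have h1 := sq_sum_prod_sub_prod_mul_le
    (sampleWeight_pos hδ0 hδ (Function.update v j (!v j))) (sum_sampleWeight hk δ v)
    (sum_sampleWeight hk δ _) hh
  -- The divergence is at most `exp (22 / 128) - 1 < 1 / 4`.
  refine abs_le_of_sq_le_sq (h1.trans ?_) (by norm_num)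
  have hx : (n : ℝ) * (22 * δ ^ 2 / k) ≤ 22 / 128 := by
    rw [mul_div_assoc', div_le_iff₀ hk0]; linarith
  have h2 : (1 + 22 * δ ^ 2 / k) ^ n ≤ Real.exp (22 / 128) := by
    refine le_trans ?_ (Real.exp_le_exp.2 hx)
    rw [Real.exp_nat_mul]
    refine pow_le_pow_left₀ (by positivity) ?_ n
    linarith [Real.add_one_le_exp (22 * δ ^ 2 / k)]
  have h3 := Real.exp_bound_div_one_sub_of_interval (x := 22 / 128) (by norm_num) (by norm_num)
  have h4 := pow_le_pow_left₀ (Finset.sum_nonneg fun s _ => div_nonneg (sq_nonneg _)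
    (sampleWeight_pos hδ0 hδ _ _).le) (sum_sq_sampleWeight_div_le hk hδ0 hδ v j) n
  norm_num at h3 ⊢
  linarith

/-- Assouad's argument for one bit: a test for the bit `v j` errs with probability at least `1 / 4`
on average over the parameters `v`, since flipping the bit hardly changes the distribution. -/
lemma two_pow_div_four_le_sum_error {k n : ℕ} (hk : 1 ≤ k) {δ : ℝ} (hδ0 : 0 ≤ δ)
    (hδ : δ ≤ 1 / 4) (hn : n * δ ^ 2 ≤ k / 128) (j : Fin k)
    {e : Bool → (Fin n → Fin k × Bool) → ℝ} (he0 : ∀ b z, 0 ≤ e b z)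
    (he1 : ∀ b z, e b z + e (!b) z = 1) :
    2 ^ k / 4 ≤ ∑ v : Fin k → Bool, ∑ z, (∏ i, sampleWeight δ v (z i)) * e (v j) z := by
  set F : (Fin k → Bool) → ℝ := fun v => ∑ z, (∏ i, sampleWeight δ v (z i)) * e (v j) z with hF
  let flip : (Fin k → Bool) → (Fin k → Bool) := fun v => Function.update v j (!v j)
  have hflip : Function.Involutive flip := fun v => by simp [flip]
  have hsum : ∑ v, F (flip v) = ∑ v, F v := Equiv.sum_comp hflip.toPerm F
  have hpair : ∀ v, 1 / 2 ≤ F v + F (flip v) := fun v => by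
    have h1 := abs_sum_prod_sampleWeight_sub_le hk hδ0 hδ hn v j (h := e (v j)) fun z =>
      abs_le.2 ⟨by linarith [he0 (v j) z], by linarith [he0 (!v j) z, he1 (v j) z]⟩
    have h2 : F (flip v) = 1 - ∑ z, (∏ i, sampleWeight δ (flip v) (z i)) * e (v j) z := by
      have h3 : (1 : ℝ) = ∑ z : Fin n → Fin k × Bool, ∏ i, sampleWeight δ (flip v) (z i) := by
        rw [← Fintype.sum_pow, sum_sampleWeight hk, one_pow]
      rw [h3, ← Finset.sum_sub_distrib]
      refine Finset.sum_congr rfl fun z _ => ?_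
      rw [show flip v j = !v j by simp [flip], eq_sub_of_add_eq' (he1 (v j) z)]
      ring
    simp only [sub_mul, Finset.sum_sub_distrib] at h1
    have := (abs_le.1 h1).1
    rw [h2]
    simp only [hF, flip]
    linarith
  have h := Finset.sum_le_sum fun v (_ : v ∈ Finset.univ) => hpair v
  rw [Finset.sum_add_distrib, hsum] at h
  simp only [Finset.sum_const, Finset.card_univ, Fintype.card_pi, Fintype.card_bool,
    Finset.prod_const, Fintype.card_fin, nsmul_eq_mul] at h
  push_cast at h
  linarith

/-! ### Processes that repeat each independent sample `τ` times -/

section BlockLaw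

variable {Ξ : Type} [MeasurableSpace Ξ] (π : Measure Ξ) [IsProbabilityMeasure π] (τ : ℕ)

/-- The law of the process that repeats each of a sequence of independent samples of `π` for `τ`
steps: at index `i` it takes the value of the independent sample with index `i / τ`. -/
noncomputable def blockLaw : Measure (ℕ → Ξ) :=
  (Measure.infinitePi fun _ : ℕ => π).map fun ζ i => ζ (i / τ)

lemma measurable_blockRepeat : Measurable fun (ζ : ℕ → Ξ) (i : ℕ) => ζ (i / τ) :=
  measurable_pi_lambda _ fun _ => measurable_pi_apply _

instance : IsProbabilityMeasure (blockLaw π τ) :=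
  Measure.isProbabilityMeasure_map (measurable_blockRepeat τ).aemeasurable

lemma blockLaw_map_eval (i : ℕ) : (blockLaw π τ).map (fun ω => ω i) = π := by
  rw [blockLaw, Measure.map_map (measurable_pi_apply i) (measurable_blockRepeat τ)]
  exact Measure.infinitePi_map_eval _ (i / τ)

lemma indepFun_blockLaw {τ : ℕ} (hτ : 1 ≤ τ) (t : ℕ) :
    IndepFun (fun (ω : ℕ → Ξ) (i : Fin t) => ω i) (fun ω => ω (t + τ - 1)) (blockLaw π τ) := by
  have hX : Measurable fun (ω : ℕ → Ξ) (i : Fin t) => ω i :=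
    measurable_pi_lambda _ fun _ => measurable_pi_apply _
  have hY : Measurable fun ω : ℕ → Ξ => ω (t + τ - 1) := measurable_pi_apply _
  -- The index of the independent sample behind the entry `t + τ - 1` exceeds all those behind the
  -- first `t` entries; for `t = 0` there is nothing to show.
  set m := (t + τ - 1) / τ
  have hlt : ∀ i : Fin t, (i : ℕ) / τ < m := fun i => by
    have h : (i : ℕ) + τ ≤ t + τ - 1 := by omega
    have h2 := Nat.div_le_div_right (c := τ) h
    rw [Nat.add_div_right _ (by omega)] at h2
    exact h2
  have hind : iIndepFun (fun (i : ℕ) (ζ : ℕ → Ξ) => ζ i) (Measure.infinitePi fun _ : ℕ => π) :=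
    iIndepFun_infinitePi (X := fun _ x => x) fun _ => measurable_id
  have h := hind.indepFun_finset (Finset.range m) {m} (by simp) fun i => measurable_pi_apply i
  have hφ : Measurable fun (y : Finset.range m → Ξ) (i : Fin t) =>
      y ⟨(i : ℕ) / τ, Finset.mem_range.2 (hlt i)⟩ :=
    measurable_pi_lambda _ fun _ => measurable_pi_apply _
  have hψ : Measurable fun y : ({m} : Finset ℕ) → Ξ => y ⟨m, Finset.mem_singleton_self m⟩ :=
    measurable_pi_apply _
  have h2 := h.comp hφ hψ
  rw [indepFun_iff_map_prod_eq_prod_map_map hX.aemeasurable hY.aemeasurable, blockLaw,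
    Measure.map_map (hX.prodMk hY) (measurable_blockRepeat τ),
    Measure.map_map hX (measurable_blockRepeat τ), Measure.map_map hY (measurable_blockRepeat τ)]
  exact (indepFun_iff_map_prod_eq_prod_map_map
    (hX.comp (measurable_blockRepeat τ)).aemeasurable
    (hY.comp (measurable_blockRepeat τ)).aemeasurable).1 h2

lemma condDistrib_blockLaw_ae_eq [StandardBorelSpace Ξ] [Nonempty Ξ] {τ : ℕ} (hτ : 1 ≤ τ) (t : ℕ) :
    ∀ᵐ ω ∂blockLaw π τ, condDistrib (fun ω' : ℕ → Ξ => ω' (t + τ - 1))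
      (fun (ω' : ℕ → Ξ) (i : Fin t) => ω' i) (blockLaw π τ) (fun i : Fin t => ω i) = π := by
  have hX : Measurable fun (ω : ℕ → Ξ) (i : Fin t) => ω i :=
    measurable_pi_lambda _ fun _ => measurable_pi_apply _
  have hY : Measurable fun ω : ℕ → Ξ => ω (t + τ - 1) := measurable_pi_apply _
  have h := (indepFun_iff_map_prod_eq_prod_map_map hX.aemeasurable hY.aemeasurable).1
    (indepFun_blockLaw π hτ t)
  rw [blockLaw_map_eval, ← Measure.compProd_const] at h
  exact ae_of_ae_map hX.aemeasurable
    (condDistrib_ae_eq_of_measure_eq_compProd _ hY.aemeasurable h)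

/-- The expectation of a statistic of the first `T ≤ n * τ` entries of the process, for a finite
sample space, in terms of the `n` independent samples that determine these entries. -/
lemma lintegral_blockLaw [Fintype Ξ] [MeasurableSingletonClass Ξ] [Inhabited Ξ] {τ n T : ℕ}
    (hτ : 1 ≤ τ) (hT : T ≤ n * τ) (g : (ℕ → Ξ) → ℝ≥0∞)
    (hg : ∀ ω ω' : ℕ → Ξ, (∀ i < T, ω i = ω' i) → g ω = g ω') :
    ∫⁻ ω, g ω ∂blockLaw π τ =
      ∑ z : Fin n → Ξ, g (fun i => if h : i / τ < n then z ⟨i / τ, h⟩ else default) *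
        ∏ i, π {z i} := by
  have hR : Measurable fun (ω : ℕ → Ξ) (i : Fin T) => ω i :=
    measurable_pi_lambda _ fun _ => measurable_pi_apply _
  have hg' : g = (fun y : Fin T → Ξ => g fun i => if h : i < T then y ⟨i, h⟩ else default) ∘
      fun (ω : ℕ → Ξ) (i : Fin T) => ω i := by
    ext ω
    exact hg _ _ fun i hi => by simp [hi]
  have hgm : Measurable g := by
    rw [hg']
    exact (Measurable.of_discrete).comp hR
  have hS : Measurable fun (ζ : ℕ → Ξ) (i : Fin n) => ζ i :=
    measurable_pi_lambda _ fun _ => measurable_pi_apply _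
  have hval : ∀ ζ : ℕ → Ξ, g (fun i => ζ (i / τ)) =
      (fun z : Fin n → Ξ => g fun i => if h : i / τ < n then z ⟨i / τ, h⟩ else default)
        ((fun (ζ : ℕ → Ξ) (i : Fin n) => ζ i) ζ) := fun ζ =>
    hg _ _ fun i hi => by
      simp [(Nat.div_lt_iff_lt_mul (by omega)).2 (hi.trans_le hT)]
  rw [blockLaw, lintegral_map hgm (measurable_blockRepeat τ)]
  simp_rw [hval]
  rw [← lintegral_map (μ := Measure.infinitePi fun _ : ℕ => π)
    (f := fun z : Fin n → Ξ => g fun i => if h : i / τ < n then z ⟨i / τ, h⟩ else default)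
    (Measurable.of_discrete) hS, lintegral_fintype]
  refine Finset.sum_congr rfl fun z _ => ?_
  congr 1
  rw [Measure.map_apply hS (measurableSet_singleton z)]
  have hset : (fun (ζ : ℕ → Ξ) (i : Fin n) => ζ i) ⁻¹' {z} =
      Set.pi (Finset.range n) fun i => if h : i < n then {z ⟨i, h⟩} else Set.univ := by
    ext ζ
    simp only [Set.mem_preimage, Set.mem_singleton_iff, Set.mem_pi, Finset.coe_range, Set.mem_Iio,
      funext_iff]
    constructor
    · intro h i hi
      simpa [hi] using h ⟨i, hi⟩
    · intro h i
      simpa using h i i.2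
  rw [hset, Measure.infinitePi_pi, Finset.prod_range]
  · simp
  · intro i _
    split_ifs
    · exact measurableSet_singleton _
    · exact MeasurableSet.univ

end BlockLaw

/-! ### Answers of the oracle -/

lemma Method.answers_congr {d : ℕ} {X : Set (Fin d → ℝ)} (M : Method X) (O : Oracle X) {T : ℕ}
    {ω ω' : ℕ → O.Ξ} (h : ∀ i < T, ω i = ω' i) : M.answers O ω T = M.answers O ω' T := by
  induction T with
  | zero => rfl
  | succ T ih =>
    have := ih fun i hi => h i (by omega)
    simp only [Method.answers, this, h T (by omega)]

/-- The first `t` answers to the method `M`, for an oracle given by its map `grad` alone: they do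
not depend on the law of the samples. -/
def Method.answersOfGrad {d : ℕ} {X : Set (Fin d → ℝ)} {Ξ : Type} (M : Method X)
    (grad : X → Ξ → Fin d → ℝ) (ω : ℕ → Ξ) : (t : ℕ) → Fin t → Fin d → ℝ
  | 0 => Fin.elim0
  | t + 1 => Fin.snoc (α := fun _ => Fin d → ℝ) (M.answersOfGrad grad ω t)
      (grad (M.query t (M.answersOfGrad grad ω t)) (ω t))

lemma Method.answers_eq_answersOfGrad {d : ℕ} {X : Set (Fin d → ℝ)} (M : Method X) (O : Oracle X)
    (ω : ℕ → O.Ξ) (T : ℕ) : M.answers O ω T = M.answersOfGrad O.grad ω T := by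
  induction T with
  | zero => rfl
  | succ T ih => simp only [Method.answers, Method.answersOfGrad, ih]

lemma Method.le_toENNReal_optGap {d : ℕ} {X : Set (Fin d → ℝ)} (M : Method X) (T : ℕ)
    (f : (Fin d → ℝ) → ℝ) (O : Oracle X) (ω : ℕ → O.Ξ) {y : Fin d → ℝ} (hy : y ∈ X) :
    ENNReal.ofReal (f (M.estimate T (M.answers O ω T)) - f y) ≤ (M.optGap T f O ω).toENNReal := by
  have h : ((f (M.estimate T (M.answers O ω T)) - f y : ℝ) : EReal) ≤ M.optGap T f O ω := by
    rw [EReal.coe_sub]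
    exact EReal.sub_le_sub le_rfl (iInf_le (fun x : X => (f x : EReal)) ⟨y, hy⟩)
  have h2 := EReal.toENNReal_le_toENNReal h
  rwa [EReal.toENNReal_of_ne_top (EReal.coe_ne_top _), EReal.toReal_coe] at h2

/-! ### The hard oracles -/

/-- The distribution on samples with weights `sampleWeight`. -/
noncomputable def samplePMF {k : ℕ} (hk : 1 ≤ k) {δ : ℝ} (hδ0 : 0 ≤ δ) (hδ : δ ≤ 1 / 4)
    (v : Fin k → Bool) : PMF (Fin k × Bool) :=
  PMF.ofFintype (fun s => ENNReal.ofReal (sampleWeight δ v s)) (by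
    rw [← ENNReal.ofReal_sum_of_nonneg fun s _ => (sampleWeight_pos hδ0 hδ v s).le,
      sum_sampleWeight hk, ENNReal.ofReal_one])

/-- The oracle that answers with `hardGrad`, on samples of the distribution `μ` that are repeated
`τ` times each. -/
noncomputable def hardOracle {d k : ℕ} [NeZero k] (X : Set (Fin d → ℝ)) (a : Fin d → ℝ) (r A : ℝ)
    (block : Fin d → Fin k) (τ : ℕ) (μ : PMF (Fin k × Bool)) : Oracle X where
  Ξ := Fin k × Bool
  law := blockLaw μ.toMeasure τ
  grad x s := hardGrad a r A block x s
  measurable_grad := measurable_hardGrad X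

section HardOracle

variable {d k : ℕ} [NeZero k] {X : Set (Fin d → ℝ)} {a : Fin d → ℝ} {r A : ℝ}
  {block : Fin d → Fin k} {τ : ℕ}

lemma hardOracle_mem_admissibleOracles {G δ : ℝ} {p : ℝ≥0∞} (hτ : 1 ≤ τ) (hA : 0 ≤ A)
    (hk : 1 ≤ k) (hδ0 : 0 ≤ δ) (hδ : δ ≤ 1 / 4) (v : Fin k → Bool)
    (hG : ∀ (j : Fin k) (g : Fin d → ℝ), (∀ i, |g i| = if block i = j then A else 0) →
      ellNorm p g ≤ G) :
    hardOracle X a r A block τ (samplePMF hk hδ0 hδ v) ∈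
      admissibleOracles X (hardFun a r A δ block v) τ G p := by
  refine ⟨(samplePMF hk hδ0 hδ v).toMeasure, PMF.toMeasure.isProbabilityMeasure _,
    fun x s => ?_, fun x => ?_, fun t => ?_⟩
  · refine hG s.1 _ fun i => ?_
    simp only [hardOracle, hardGrad]
    split_ifs
    · rw [abs_mul, abs_absSlope, mul_one, abs_of_nonneg hA]
    · exact abs_zero
  · have h := sum_sampleWeight_smul_hardGrad_mem (a := a) (r := r) (block := block) (v := v)
      hA hδ0 hδ X x
    have hint : ∫ s, hardGrad a r A block x s ∂(samplePMF hk hδ0 hδ v).toMeasure =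
        ∑ s, sampleWeight δ v s • hardGrad a r A block x s := by
      rw [PMF.integral_eq_sum]
      refine Finset.sum_congr rfl fun s _ => ?_
      congr 1
      exact ENNReal.toReal_ofReal (sampleWeight_pos hδ0 hδ v s).le
    rw [← hint] at h
    exact h
  · filter_upwards [condDistrib_blockLaw_ae_eq (samplePMF hk hδ0 hδ v).toMeasure hτ t] with ω hω
    have : (hardOracle X a r A block τ (samplePMF hk hδ0 hδ v)).condLaw t (t + τ) ω =
      (samplePMF hk hδ0 hδ v).toMeasure := hω
    rw [this]
    simp [tvDist]

omit [NeZero k] in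
lemma hardFun_mem_convexLipschitz {G δ : ℝ} {q : ℝ≥0∞} (hX : Convex ℝ X) (hA : 0 ≤ A)
    (hδ0 : 0 ≤ δ) (hδ : δ ≤ 1 / 4) (v : Fin k → Bool)
    (hq : ∀ x : Fin d → ℝ, A / k * ∑ i, |x i| ≤ G * ellNorm q x) :
    hardFun a r A δ block v ∈ convexLipschitz X G q :=
  ⟨convexOn_of_forall_subdifferential_nonempty hX fun x _ =>
      ⟨_, sum_sampleWeight_smul_hardGrad_mem hA hδ0 hδ X x⟩,
    fun x _ y _ => (abs_hardFun_sub_le hA hδ0 hδ x y).trans (hq (x - y))⟩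

/-! ### The lower bound -/

/-- The lower bound for a scheme that partitions the coordinates into `k` blocks, one unknown bit
for each. -/
theorem le_minimaxError_of_block {G : ℝ} {p q : ℝ≥0∞} (hX : Convex ℝ X) (hr : 0 < r)
    (ha : Metric.closedBall a r ⊆ X) (hτ : 1 ≤ τ) (hA : 0 ≤ A)
    (hG : ∀ (j : Fin k) (g : Fin d → ℝ), (∀ i, |g i| = if block i = j then A else 0) →
      ellNorm p g ≤ G)
    (hq : ∀ x : Fin d → ℝ, A / k * ∑ i, |x i| ≤ G * ellNorm q x) {T : ℕ} (hT : k * τ ≤ T) :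
    ENNReal.ofReal (A * d * r / (32 * k) * √(k * τ / T)) ≤
      minimaxError T (convexLipschitz X G q) X τ G p := by
  have hk : 1 ≤ k := NeZero.one_le
  have hk0 : 0 < (k : ℝ) := by positivity
  have hτT : τ ≤ T := (Nat.le_mul_of_pos_left τ hk).trans hT
  have hT0 : 0 < (T : ℝ) := by exact_mod_cast hτ.trans hτT
  -- With this bias, `n ≤ 2 * T / τ` samples satisfy `n * δ ^ 2 ≤ k / 128`.
  set δ : ℝ := √(k * τ / T) / 16 with hδdef
  have hδ0 : 0 ≤ δ := by positivity
  have hδ : δ ≤ 1 / 4 := by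
    have : √((k : ℝ) * τ / T) ≤ 1 := by
      rw [Real.sqrt_le_one, div_le_one hT0]
      exact_mod_cast hT
    rw [hδdef]; linarith
  -- The number of independent samples that determine the first `T` entries of the process.
  set n := T / τ + 1 with hndef
  have hTn : T ≤ n * τ := by
    have h1 := Nat.div_add_mod' T τ
    have h2 := Nat.mod_lt T hτ
    rw [hndef, add_mul]; omega
  have hn : n * δ ^ 2 ≤ k / 128 := by
    have h1 : n * τ ≤ 2 * T := by
      have := Nat.div_mul_le_self T τ
      rw [hndef, add_mul]; omega
    have h2 : (n : ℝ) * τ ≤ 2 * T := by exact_mod_cast h1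
    rw [hδdef, div_pow, Real.sq_sqrt (by positivity)]
    have h3 : (n : ℝ) * (k * τ / T / 16 ^ 2) = (n * τ) * k / (256 * T) := by
      field_simp; norm_num
    rw [h3, div_le_iff₀ (by positivity)]
    have := mul_le_mul_of_nonneg_right h2 hk0.le
    linarith
  refine le_iInf fun M => ?_
  set S := ⨆ f ∈ convexLipschitz X G q, ⨆ O ∈ admissibleOracles X f τ G p, M.expectedGap T f O
  set C : ℝ := A / k * (2 * δ * r)
  have hC : 0 ≤ C := by positivity
  -- The estimate as a function of the independent samples is the same for all parameters.
  let ext : (Fin n → Fin k × Bool) → ℕ → Fin k × Bool :=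
    fun z i => if h : i / τ < n then z ⟨i / τ, h⟩ else default
  let est : (Fin n → Fin k × Bool) → Fin d → ℝ := fun z =>
    M.estimate T (M.answersOfGrad (fun x : X => hardGrad a r A block x) (ext z) T)
  -- `S` bounds the expected loss of each parameter; the rest of the proof averages over them.
  have hone : ∀ v : Fin k → Bool, ENNReal.ofReal (∑ z, (∏ i, sampleWeight δ v (z i)) *
      (C * ∑ i, wrongSide (v (block i)) (est z i - a i))) ≤ S := by
    intro v
    have hW : ∀ z : Fin n → Fin k × Bool, 0 ≤ ∏ i, sampleWeight δ v (z i) := fun z =>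
      Finset.prod_nonneg fun i _ => (sampleWeight_pos hδ0 hδ v _).le
    have hy : (fun i => a i - bitSign (v (block i)) * r) ∈ X := by
      refine ha ?_
      rw [Metric.mem_closedBall, dist_pi_le_iff hr.le]
      intro i
      rw [Real.dist_eq]
      cases v (block i) <;> simp [bitSign, abs_of_pos hr]
    refine le_trans ?_ (le_iSup₂_of_le (hardFun a r A δ block v)
      (hardFun_mem_convexLipschitz hX hA hδ0 hδ v hq)
      (le_iSup₂_of_le _ (hardOracle_mem_admissibleOracles hτ hA hk hδ0 hδ v hG) le_rfl))
    have hint := lintegral_blockLaw (samplePMF hk hδ0 hδ v).toMeasure hτ hTn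
      (fun ω => (M.optGap T (hardFun a r A δ block v)
        (hardOracle X a r A block τ (samplePMF hk hδ0 hδ v)) ω).toENNReal)
      (fun ω ω' h => by
        simp only [Method.optGap, Method.answers_congr M
          (hardOracle X a r A block τ (samplePMF hk hδ0 hδ v)) h])
    refine le_trans ?_ hint.ge
    rw [ENNReal.ofReal_sum_of_nonneg fun z _ => mul_nonneg (hW z)
      (mul_nonneg hC (Finset.sum_nonneg fun i _ => wrongSide_nonneg _ _))]
    refine Finset.sum_le_sum fun z _ => ?_
    rw [mul_comm, ENNReal.ofReal_mul (mul_nonneg hC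
      (Finset.sum_nonneg fun i _ => wrongSide_nonneg _ _))]
    refine mul_le_mul' ?_ (le_of_eq ?_)
    · refine le_trans (ENNReal.ofReal_le_ofReal ?_) (M.le_toENNReal_optGap T
        (hardFun a r A δ block v) (hardOracle X a r A block τ (samplePMF hk hδ0 hδ v)) (ext z) hy)
      have hans := Method.answers_eq_answersOfGrad M
        (hardOracle X a r A block τ (samplePMF hk hδ0 hδ v)) (ext z) T
      exact (le_hardFun_sub hA hr.le hδ0 hδ (est z)).trans_eq
        (congrArg (fun y => hardFun a r A δ block v (M.estimate T y) - _) hans.symm)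
    · rw [ENNReal.ofReal_prod_of_nonneg fun i _ => (sampleWeight_pos hδ0 hδ v _).le]
      refine Finset.prod_congr rfl fun i _ => ?_
      rw [PMF.toMeasure_apply_singleton _ _ (measurableSet_singleton _)]
      rfl
  have hsum : C * (d * (2 ^ k / 4)) ≤ ∑ v : Fin k → Bool, ∑ z, (∏ i, sampleWeight δ v (z i)) *
      (C * ∑ i, wrongSide (v (block i)) (est z i - a i)) := by
    have h1 : ∑ v : Fin k → Bool, ∑ z, (∏ i, sampleWeight δ v (z i)) *
        (C * ∑ i, wrongSide (v (block i)) (est z i - a i)) =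
        C * ∑ i, ∑ v : Fin k → Bool, ∑ z, (∏ l, sampleWeight δ v (z l)) *
          wrongSide (v (block i)) (est z i - a i) := by
      rw [Finset.sum_comm (s := (Finset.univ : Finset (Fin d))), Finset.mul_sum]
      refine Finset.sum_congr rfl fun v _ => ?_
      rw [Finset.sum_comm, Finset.mul_sum]
      refine Finset.sum_congr rfl fun z _ => ?_
      rw [← Finset.mul_sum]
      ring
    rw [h1]
    refine mul_le_mul_of_nonneg_left ?_ hC
    have h2 := Finset.card_nsmul_le_sum Finset.univ
      (fun i : Fin d => ∑ v : Fin k → Bool, ∑ z, (∏ l, sampleWeight δ v (z l)) *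
          wrongSide (v (block i)) (est z i - a i)) (2 ^ k / 4) fun i _ =>
      two_pow_div_four_le_sum_error hk hδ0 hδ hn (block i)
        (e := fun b z => wrongSide b (est z i - a i)) (fun _ _ => wrongSide_nonneg _ _)
        fun _ _ => wrongSide_add_not _ _
    simpa using h2
  have htot : ENNReal.ofReal (C * (d * (2 ^ k / 4))) ≤ 2 ^ k * S := by
    refine (ENNReal.ofReal_le_ofReal hsum).trans ?_
    rw [ENNReal.ofReal_sum_of_nonneg fun v _ => Finset.sum_nonneg fun z _ => mul_nonneg
      (Finset.prod_nonneg fun i _ => (sampleWeight_pos hδ0 hδ v _).le)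
      (mul_nonneg hC (Finset.sum_nonneg fun i _ => wrongSide_nonneg _ _))]
    refine (Finset.sum_le_card_nsmul _ _ S fun v _ => hone v).trans_eq ?_
    simp
  have hval : C * (d * (2 ^ k / 4)) = 2 ^ k * (A * d * r / (32 * k) * √(k * τ / T)) := by
    simp only [C, hδdef]
    field_simp
    ring
  rw [hval, ENNReal.ofReal_mul (by positivity), ENNReal.ofReal_pow (by norm_num),
    ENNReal.ofReal_ofNat] at htot
  exact (ENNReal.mul_le_mul_iff_right (by positivity) (by finiteness)).1 htot

end HardOracle

end ErgodicOracle

theorem theorem4 :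
    ∃ c : ℝ, 0 < c ∧ ∃ N : ℕ,
      ∀ (d : ℕ) (X : Set (Fin d → ℝ)) (a : Fin d → ℝ) (r G : ℝ) (p q : ℝ≥0∞) (τ : ℕ),
        1 ≤ d → Convex ℝ X → 0 < r → Metric.closedBall a r ⊆ X → 0 < G →
        1 ≤ p → 1 / p + 1 / q = 1 → 1 ≤ τ →
        (p ≤ 2 → ∀ T : ℕ, N * d * τ ≤ T →
          ENNReal.ofReal (c * (G * r * √(d : ℝ) * √((τ : ℝ) / (T : ℝ)))) ≤
            ErgodicOracle.minimaxError T (ErgodicOracle.convexLipschitz X G q) X τ G p) ∧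
        (2 ≤ p → ∀ T : ℕ, N * τ ≤ T →
          ENNReal.ofReal
              (c * (G * r * (d : ℝ) ^ (1 / q).toReal * √((τ : ℝ) / (T : ℝ)))) ≤
            ErgodicOracle.minimaxError T (ErgodicOracle.convexLipschitz X G q) X τ G p) := by
  refine ⟨1 / 32, by norm_num, 1, ?_⟩
  intro d X a r G p q τ hd hX hr ha hG hp hpq hτ
  have hd0 : 0 < (d : ℝ) := by positivity
  have hq : 1 ≤ q := by
    have h : 1 / q ≤ 1 := le_add_self.trans_eq hpq
    simpa using h
  have hsum : (1 / p).toReal + (1 / q).toReal = 1 := by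
    rw [← ENNReal.toReal_add, hpq, ENNReal.toReal_one]
    · intro h; simp [h] at hpq
    · intro h; simp [h] at hpq
  constructor
  · intro _ T hT
    -- Each coordinate forms a block of its own.
    have : NeZero d := ⟨by omega⟩
    have : Fact (1 ≤ q) := ⟨hq⟩
    have h := ErgodicOracle.le_minimaxError_of_block (block := id) (p := p) (q := q) (A := G)
      (G := G) hX hr ha hτ hG.le (fun j g hg => ?_) (fun x => ?_)
      (show d * τ ≤ T by simpa using hT)
    · refine le_trans (ENNReal.ofReal_le_ofReal (le_of_eq ?_)) h
      rw [mul_div_assoc (d : ℝ) τ T, Real.sqrt_mul hd0.le]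
      field_simp
    · rw [ErgodicOracle.ellNorm_of_eq_single hp (j := j), hg j]
      · simp
      · intro i hij
        simpa [hij] using hg i
    · rw [div_mul_eq_mul_div, mul_div_assoc]
      refine mul_le_mul_of_nonneg_left ?_ hG.le
      rw [div_le_iff₀ hd0, mul_comm]
      refine (Finset.sum_le_card_nsmul _ _ (ErgodicOracle.ellNorm q x) fun i _ => ?_).trans_eq
        (by simp)
      exact PiLp.norm_apply_le (WithLp.toLp q x) i
  · intro _ T hT
    -- All coordinates form one block, and the answers have full support.
    have hpow : 0 < (d : ℝ) ^ (1 / p).toReal := Real.rpow_pos_of_pos hd0 _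
    have h := ErgodicOracle.le_minimaxError_of_block (k := 1) (block := fun _ => 0) (p := p)
      (q := q) (A := G / (d : ℝ) ^ (1 / p).toReal) (G := G) hX hr ha hτ (by positivity)
      (fun j g hg => ?_) (fun x => ?_) hT
    · refine le_trans (ENNReal.ofReal_le_ofReal (le_of_eq ?_)) h
      rw [show (1 / q).toReal = 1 - (1 / p).toReal by linarith, Real.rpow_sub hd0, Real.rpow_one]
      push_cast
      rw [one_mul]
      field_simp
    · refine (ErgodicOracle.ellNorm_le_of_forall_abs_le hp (A := G / (d : ℝ) ^ (1 / p).toReal)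
        (by positivity) fun i => ?_).trans_eq (mul_div_cancel₀ _ hpow.ne')
      rw [hg i]
      simp [Subsingleton.elim j 0]
    · have := ErgodicOracle.sum_abs_le_ellNorm hq hpq x
      rw [Nat.cast_one, div_one, div_mul_eq_mul_div, mul_div_assoc]
      refine mul_le_mul_of_nonneg_left ?_ hG.le
      rwa [div_le_iff₀' hpow]
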